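/- Let $k\ge 3$ and $n\ge 2k+6$ be integers. *The complex.* Two pairs $\{i<j\},\{a<b\}$ in $\binom{[n]}2$ cross if $i<a<j<b$ or $a<i<b<j$. The length of $\{i,j\}$ is $\min\{|j-i|,\,n-|j-i|\}$, and a pair is relevant if its length is at least $k+1$. The $k$-associahedron $\overline{\Delta}_{k,n}$ is the simplicial complex of all sets of relevant pairs that contain no $k+1$ pairwise crossing elements. *Realization.* Let $(v_e)_{e\in\binom{[n]}2}$ be the rows of a real matrix with rows indexed by $\binom{[n]}2$, and let $\bar v_e$ be the image of $v_e$ in the quotient of the row space by the span of the rows of all non-relevant pairs. The matrix realizes $\overline{\Delta}_{k,n}$ as a (complete simplicial) fan if $(\bar v_e)_{e\in F}$ is linearly independent for every face $F$, $\operatorname{cone}(\bar v_F)\cap\operatorname{cone}(\bar v_G)=\operatorname{cone}(\bar v_{F\cap G})$ for all faces $F,G$, and the cones $\operatorname{cone}(\bar v_F)$ of all faces cover the whole quotient space. *Matrices.* Consider matrices with rows indexed by the pairs $\{i<j\}$ and columns divided into $n$ blocks of size $d$, where the row of $\{i<j\}$ is zero outside blocks $i$ and $j$. The cofactor matrix $C_d(\mathbf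 q)$ of points $q_i=(x_i,y_i)\in\mathbb R^2$ has $\mathbf c_{ij}$ in block $i$ and $-\mathbf c_{ij}$ in block $j$, where $\mathbf c_{ij}=\big((x_i-x_j)^{d-1},(y_i-y_j)(x_i-x_j)^{d-2},\dots,(y_i-y_j)^{d-1}\big)$. For points $p_i\in\mathbb R^d$, the bar-and-joint matrix $R(\mathbf p)$ has $p_i-p_j$ in block $i$ and $p_j-p_i$ in block $j$, and the hyperconnectivity matrix $H(\mathbf p)$ has $p_j$ in block $i$ and $-p_i$ in block $j$. **Theorem.** 1. If $q_1,\dots,q_n\in\mathbb R^2$ are in (strictly) convex position, labelled in cyclic order (in either direction) along the boundary of their convex hull, then $C_{2k}(\mathbf q)$ does not realize $\overline{\Delta}_{k,n}$ as a fan. 2. If $t_1<\dots<t_n$ are real numbers and $p_i=(t_i,t_i^2,\dots,t_i^{2k})$, then $R(\mathbf p)$ does not realize $\overline{\Delta}_{k,n}$ as a fan. 3. If $t_1<\dots<t_n$ are real numbers and $p_i=(1,t_i,\dots,t_i^{2k-1})$, then $H(\mathbf p)$ does not realize $\overline{\Delta}_{k,n}$ as a fan. -/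

import Mathlib

/-- The elements of `binom([n], 2)`: pairs `i < j` of labels of the vertices of an `n`-gon
(labels `0, …, n - 1`). -/
abbrev Edge (n : ℕ) : Type := {e : Fin n × Fin n // e.1 < e.2}

namespace Edge

/-- The smaller endpoint. -/
abbrev fst {n : ℕ} (e : Edge n) : Fin n := e.1.1

/-- The larger endpoint. -/
abbrev snd {n : ℕ} (e : Edge n) : Fin n := e.1.2

/-- Two edges cross if their endpoints strictly interleave. -/
def Cross {n : ℕ} (e f : Edge n) : Prop :=
  (e.fst < f.fst ∧ f.fst < e.snd ∧ e.snd < f.snd) ∨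
    (f.fst < e.fst ∧ e.fst < f.snd ∧ f.snd < e.snd)

/-- Cyclic length `min (j - i) (n - (j - i))` of the edge `{i, j}`, `i < j`. -/
def length {n : ℕ} (e : Edge n) : ℕ :=
  min ((e.snd : ℕ) - (e.fst : ℕ)) (n - ((e.snd : ℕ) - (e.fst : ℕ)))

/-- Relevant edges: those of length at least `k + 1`. The others, of length at most `k`, belong
to every `k`-triangulation. -/
def Relevant {n : ℕ} (k : ℕ) (e : Edge n) : Prop := k + 1 ≤ e.length

end Edge

/-- `S` contains no `m` pairwise crossing edges. -/
def CrossingFree {n : ℕ} (m : ℕ) (S : Finset (Edge n)) : Prop :=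
  ∀ C ⊆ S, C.card = m → ¬ (C : Set (Edge n)).Pairwise Edge.Cross

/-- The (faces of the) `k`-associahedron on the `n`-gon, i.e. the reduced complex: all
`(k + 1)`-crossing-free sets of relevant edges. The empty face is included. -/
def multiassociahedron (k n : ℕ) : Set (Finset (Edge n)) :=
  {F | (∀ e ∈ F, e.Relevant k) ∧ CrossingFree (k + 1) F}

/-- The convex cone generated by the vectors `v i`, `i ∈ F`. -/
def coneOf {ι E : Type*} [AddCommGroup E] [Module ℝ E] (v : ι → E) (F : Finset ι) : Set E :=
  {x | ∃ c : ι → ℝ, (∀ i, 0 ≤ c i) ∧ x = ∑ i ∈ F, c i • v i}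

/-- The vector configuration `v` realizes the simplicial complex `Δ` as a complete simplicial fan
in the linear span of the configuration: the cones of the faces of `Δ` are simplicial, any two of
them intersect in the cone of the common face, and together they cover the whole space. -/
structure RealizesCompleteFan {ι E : Type*} [DecidableEq ι] [AddCommGroup E] [Module ℝ E]
    (Δ : Set (Finset ι)) (v : ι → E) : Prop where
  simplicial : ∀ F ∈ Δ, LinearIndepOn ℝ v (F : Set ι)
  inter : ∀ F ∈ Δ, ∀ G ∈ Δ, coneOf v F ∩ coneOf v G = coneOf v (F ∩ G)
  complete : (⋃ F ∈ Δ, coneOf v F) = (Submodule.span ℝ (Set.range v) : Set E)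

/-- The span of the rows of the irrelevant and boundary edges (those of length at most `k`). -/
def shortSpan {n : ℕ} {κ : Type*} (k : ℕ) (M : Matrix (Edge n) κ ℝ) : Submodule ℝ (κ → ℝ) :=
  Submodule.span ℝ (M.row '' {e | ¬ e.Relevant k})

/-- The rows of `M` realize the `k`-associahedron on the `n`-gon as a complete fan. The reduced
complex forgets the edges of length at most `k`, which lie in every `k`-triangulation, so the
vector configuration is the contraction of the rows at those edges: the images of the rows in the
quotient by the span of the rows of those edges. -/
def RealizesMultiassociahedron {n : ℕ} {κ : Type*} (k : ℕ) (M : Matrix (Edge n) κ ℝ) : Prop :=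
  RealizesCompleteFan (multiassociahedron k n) (fun e => (shortSpan k M).mkQ (M.row e))

/-- The bar-and-joint rigidity matrix of points `p i` in `ℝ^d`: the row of `{i, j}`, `i < j`, has
`p i - p j` in block `i` and `p j - p i` in block `j`. -/
def barJointMatrix {n d : ℕ} (p : Fin n → Fin d → ℝ) : Matrix (Edge n) (Fin n × Fin d) ℝ :=
  Matrix.of fun e c =>
    if c.1 = e.fst then p e.fst c.2 - p e.snd c.2
    else if c.1 = e.snd then p e.snd c.2 - p e.fst c.2
    else 0

/-- The hyperconnectivity matrix of points `p i` in `ℝ^d`: the row of `{i, j}`, `i < j`, has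
`p j` in block `i` and `- p i` in block `j`. -/
def hyperconnectivityMatrix {n d : ℕ} (p : Fin n → Fin d → ℝ) :
    Matrix (Edge n) (Fin n × Fin d) ℝ :=
  Matrix.of fun e c =>
    if c.1 = e.fst then p e.snd c.2
    else if c.1 = e.snd then - p e.fst c.2
    else 0

/-- The vector `(x^(d-1), y x^(d-2), …, y^(d-1))` for `(x, y) = a - b`. -/
def cofactorVec (d : ℕ) (a b : ℝ × ℝ) : Fin d → ℝ :=
  fun m => (a.2 - b.2) ^ (m : ℕ) * (a.1 - b.1) ^ (d - 1 - (m : ℕ))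

/-- The `d`-dimensional cofactor rigidity matrix of points `q i` in the plane: the row of
`{i, j}`, `i < j`, has `c i j` in block `i` and `- c i j` in block `j`, where `c i j` is
`cofactorVec d (q i) (q j)`. -/
def cofactorMatrix {n : ℕ} (d : ℕ) (q : Fin n → ℝ × ℝ) : Matrix (Edge n) (Fin n × Fin d) ℝ :=
  Matrix.of fun e c =>
    if c.1 = e.fst then cofactorVec d (q e.fst) (q e.snd) c.2
    else if c.1 = e.snd then - cofactorVec d (q e.fst) (q e.snd) c.2
    else 0

/-- Twice the signed area of the triangle `a b c`: positive iff `a, b, c` is a counterclockwise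
triple, zero iff the three points are collinear. -/
def signedArea (a b c : ℝ × ℝ) : ℝ :=
  (b.1 - a.1) * (c.2 - a.2) - (b.2 - a.2) * (c.1 - a.1)

/-- The points are in (strictly) convex position and labelled along the boundary of their convex
hull: going through the labels in order one goes around the convex polygon once, either
counterclockwise or clockwise. -/
def InConvexPosition {n : ℕ} (q : Fin n → ℝ × ℝ) : Prop :=
  (∀ i j l : Fin n, i < j → j < l → 0 < signedArea (q i) (q j) (q l)) ∨
    (∀ i j l : Fin n, i < j → j < l → signedArea (q i) (q j) (q l) < 0)

/-- The point `(t, t^2, …, t^d)` of the moment curve in `ℝ^d`. -/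
def momentPoint (d : ℕ) (t : ℝ) : Fin d → ℝ := fun m => t ^ ((m : ℕ) + 1)

/-- The point `(1, t, …, t^(d-1))` of the homogeneous moment curve in `ℝ^d`, used for
hyperconnectivity, which is invariant under linear but not under affine transformations. -/
def linearMomentPoint (d : ℕ) (t : ℝ) : Fin d → ℝ := fun m => t ^ (m : ℕ)

/-! Suppose the rows satisfy a dependency that involves a relevant edge and whose positive and
negative supports both contain no `k + 1` pairwise crossing edges. In the quotient the relevant
parts of the two supports are disjoint faces whose cones share a point. In a fan that point is `0`,
and independence on faces then kills every relevant coefficient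
(`not_realizesMultiassociahedron_of_dependency`).

Such a dependency comes from `edgeStress`. For `2k + 3` vertices `S` and a point `r`, the weights
`[i j r] / ∏ [i j l]`, with `l` over the rest of `S` and brackets for signed areas, are in
equilibrium for the cofactor matrix by a Lagrange-type identity
(`sum_prod_linear_div_prod_det_eq_zero`). In convex position their sign is `(-1)` to the number of
vertices of `S` between `i` and `j`, times the side of `ij` on which `r` lies
(`exists_edgeStress_eq`).

A `(k + 1)`-crossing inside `S` omits one vertex `v` and contains every edge halving the rest
(`exists_missing_vertex`). So for each `v` it suffices to find a halving edge of coefficient `≤ 0`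
and one of coefficient `≥ 0`. With `r` the intersection of two diagonals `ac` and `bd`, both of
these have coefficient `0` and settle most `v`. An edge `xy` and a further edge at `a` or `c` settle
the others. The side of `xy` containing `r` is not known, so there are two choices of `S`, giving
`xy` opposite parities (`exists_edgeStress_crossing_free`).

For points on the parabola `(t, t²)` the same stress, multiplied by positive powers of `t j - t i`,
is a dependency of the bar-and-joint and hyperconnectivity matrices. -/

/-! ### Dependencies that obstruct a fan -/

/-- A linear dependency among the rows whose positive and negative parts are both
`(k + 1)`-crossing-free, and which involves some relevant edge, is incompatible with a fan. -/
theorem not_realizesMultiassociahedron_of_dependency {n k : ℕ} {κ : Type*}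
    {M : Matrix (Edge n) κ ℝ} (ω : Edge n → ℝ) (hdep : ∑ e, ω e • M.row e = 0)
    (hpos : ∀ C : Finset (Edge n), C.card = k + 1 → (C : Set (Edge n)).Pairwise Edge.Cross →
      ∃ e ∈ C, ω e ≤ 0)
    (hneg : ∀ C : Finset (Edge n), C.card = k + 1 → (C : Set (Edge n)).Pairwise Edge.Cross →
      ∃ e ∈ C, 0 ≤ ω e)
    (hrel : ∃ e : Edge n, e.Relevant k ∧ ω e ≠ 0) :
    ¬ RealizesMultiassociahedron k M := by
  classical
  intro h
  set v : Edge n → ((κ → ℝ) ⧸ shortSpan k M) := fun e => (shortSpan k M).mkQ (M.row e) with hv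
  have hshort : ∀ e : Edge n, ¬ e.Relevant k → v e = 0 := by
    intro e he
    rw [hv]
    simp only [Submodule.mkQ_apply, Submodule.Quotient.mk_eq_zero]
    exact Submodule.subset_span ⟨e, he, rfl⟩
  have hsum : ∑ e, ω e • v e = 0 := by
    have := congrArg (shortSpan k M).mkQ hdep
    simpa only [map_sum, map_smul, map_zero] using this
  set P : Finset (Edge n) := Finset.univ.filter fun e => e.Relevant k ∧ 0 < ω e with hP
  set N : Finset (Edge n) := Finset.univ.filter fun e => e.Relevant k ∧ ω e < 0 with hN
  have hPΔ : P ∈ multiassociahedron k n := by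
    refine ⟨fun e he => (Finset.mem_filter.1 he).2.1, fun C hC hcard hcross => ?_⟩
    obtain ⟨e, he, hle⟩ := hpos C hcard hcross
    exact absurd (Finset.mem_filter.1 (hC he)).2.2 (not_lt.2 hle)
  have hNΔ : N ∈ multiassociahedron k n := by
    refine ⟨fun e he => (Finset.mem_filter.1 he).2.1, fun C hC hcard hcross => ?_⟩
    obtain ⟨e, he, hle⟩ := hneg C hcard hcross
    exact absurd (Finset.mem_filter.1 (hC he)).2.2 (not_lt.2 hle)
  have hPN : P ∩ N = ∅ := by
    ext e
    simp only [hP, hN, Finset.mem_inter, Finset.mem_filter, Finset.notMem_empty, iff_false]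
    rintro ⟨⟨-, -, h1⟩, -, -, h2⟩
    exact lt_asymm h1 h2
  have hsplit : ∑ e, ω e • v e = ∑ e ∈ P, ω e • v e + ∑ e ∈ N, ω e • v e := by
    rw [← Finset.sum_union (Finset.disjoint_iff_inter_eq_empty.2 hPN)]
    symm
    refine Finset.sum_subset (Finset.subset_univ _) fun e _ he => ?_
    by_cases hr : e.Relevant k
    · rcases lt_trichotomy (ω e) 0 with h0 | h0 | h0
      · exact absurd (Finset.mem_union_right _ (by simp [hN, hr, h0])) he
      · simp [h0]
      · exact absurd (Finset.mem_union_left _ (by simp [hP, hr, h0])) he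
    · simp [hshort e hr]
  have hxP : ∑ e ∈ P, ω e • v e ∈ coneOf v P := by
    -- `coneOf` asks for nonnegative coefficients at all indices, also outside the face, hence the
    -- truncation.
    refine ⟨fun e => max (ω e) 0, fun e => le_max_right _ _, Finset.sum_congr rfl fun e he => ?_⟩
    dsimp only
    rw [max_eq_left (Finset.mem_filter.1 he).2.2.le]
  have hxN : ∑ e ∈ P, ω e • v e ∈ coneOf v N := by
    refine ⟨fun e => max (-ω e) 0, fun e => le_max_right _ _, ?_⟩
    rw [eq_neg_of_add_eq_zero_left (hsplit.symm.trans hsum), ← Finset.sum_neg_distrib]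
    refine Finset.sum_congr rfl fun e he => ?_
    dsimp only
    rw [max_eq_left (neg_nonneg.2 (Finset.mem_filter.1 he).2.2.le), neg_smul]
  -- The common point lies in the cone of the empty face, so both partial sums vanish.
  have hx : ∑ e ∈ P, ω e • v e ∈ coneOf v (P ∩ N) :=
    (Set.ext_iff.1 (h.inter P hPΔ N hNΔ) _).1 ⟨hxP, hxN⟩
  rw [hPN] at hx
  obtain ⟨c, -, hc⟩ := hx
  rw [Finset.sum_empty] at hc
  have hc' : ∑ e ∈ N, ω e • v e = 0 := by
    rw [hsum, hc, zero_add] at hsplit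
    exact hsplit.symm
  obtain ⟨e, he, hne⟩ := hrel
  rcases lt_or_gt_of_ne hne with h0 | h0
  · exact hne (linearIndepOn_finset_iff.1 (h.simplicial N hNΔ) ω hc' e (by simp [hN, he, h0]))
  · exact hne (linearIndepOn_finset_iff.1 (h.simplicial P hPΔ) ω hc e (by simp [hP, he, h0]))

/-! ### The algebraic identity behind the stress -/

/-- Homogeneous Lagrange identity: a product of `|T| - 2` linear forms on the plane is annihilated
by the weights `1 / ∏ det (u j, u l)`. -/
theorem sum_prod_linear_div_prod_det_eq_zero {ι : Type*} [DecidableEq ι] (u : ι → ℝ × ℝ)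
    (L : List (ℝ × ℝ)) (T : Finset ι) (hT : T.card = L.length + 2)
    (hu : ∀ i ∈ T, ∀ j ∈ T, i ≠ j → (u i).1 * (u j).2 - (u i).2 * (u j).1 ≠ 0) :
    ∑ j ∈ T, (L.map fun c => c.1 * (u j).1 + c.2 * (u j).2).prod /
      ∏ l ∈ T.erase j, ((u j).1 * (u l).2 - (u j).2 * (u l).1) = 0 := by
  induction L generalizing T with
  | nil =>
    obtain ⟨a, b, hab, rfl⟩ := Finset.card_eq_two.1 hT
    have hd := hu a (by simp) b (by simp) hab
    have hd' := hu b (by simp) a (by simp) hab.symm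
    have e1 : ({a, b} : Finset ι).erase a = {b} := by
      ext x; simp only [Finset.mem_erase, Finset.mem_insert, Finset.mem_singleton]; grind
    have e2 : ({a, b} : Finset ι).erase b = {a} := by
      ext x; simp only [Finset.mem_erase, Finset.mem_insert, Finset.mem_singleton]; grind
    rw [Finset.sum_pair hab, e1, e2]
    simp only [List.map_nil, List.prod_nil, Finset.prod_singleton]
    rw [show (u b).1 * (u a).2 - (u b).2 * (u a).1 =
      -((u a).1 * (u b).2 - (u a).2 * (u b).1) by ring, div_neg, add_neg_cancel]
  | cons c L ih =>
    obtain ⟨a, ha, b, hb, hab⟩ := Finset.one_lt_card.1 (show 1 < T.card by simp [hT])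
    have hd := hu a ha b hb hab
    -- The factor `det (u j, u x)` kills the term `j = x` and cancels the factor `l = x` in every
    -- other denominator, leaving the identity for `T.erase x`.
    have key : ∀ x ∈ T, ∑ j ∈ T, ((u j).1 * (u x).2 - (u j).2 * (u x).1) *
        ((L.map fun c => c.1 * (u j).1 + c.2 * (u j).2).prod /
        ∏ l ∈ T.erase j, ((u j).1 * (u l).2 - (u j).2 * (u l).1)) = 0 := by
      intro x hx
      rw [← Finset.add_sum_erase _ _ hx]
      have h0 := ih (T.erase x) (by rw [Finset.card_erase_of_mem hx, hT]; simp)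
        fun i hi j hj => hu i (Finset.mem_of_mem_erase hi) j (Finset.mem_of_mem_erase hj)
      rw [show (u x).1 * (u x).2 - (u x).2 * (u x).1 = 0 by ring, zero_mul, zero_add, ← h0]
      refine Finset.sum_congr rfl fun j hj => ?_
      have hjx := Finset.ne_of_mem_erase hj
      have hne := hu j (Finset.mem_of_mem_erase hj) x hx hjx
      rw [← Finset.mul_prod_erase _ _ (Finset.mem_erase.2 ⟨hjx.symm, hx⟩),
        Finset.erase_right_comm, mul_div_assoc', mul_div_mul_left _ _ hne]
    -- Cramer's rule: `det (·, u a)` and `det (·, u b)` span the linear forms on the plane.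
    obtain ⟨α, β, hαβ⟩ : ∃ α β : ℝ, ∀ w : ℝ × ℝ, c.1 * w.1 + c.2 * w.2 =
        α * (w.1 * (u a).2 - w.2 * (u a).1) + β * (w.1 * (u b).2 - w.2 * (u b).1) := by
      refine ⟨-(c.1 * (u b).1 + c.2 * (u b).2) / ((u a).1 * (u b).2 - (u a).2 * (u b).1),
        (c.1 * (u a).1 + c.2 * (u a).2) / ((u a).1 * (u b).2 - (u a).2 * (u b).1), fun w => ?_⟩
      rw [div_mul_eq_mul_div, div_mul_eq_mul_div, ← add_div, eq_div_iff hd]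
      ring
    calc _ = α * ∑ j ∈ T, ((u j).1 * (u a).2 - (u j).2 * (u a).1) *
        ((L.map fun c => c.1 * (u j).1 + c.2 * (u j).2).prod /
        ∏ l ∈ T.erase j, ((u j).1 * (u l).2 - (u j).2 * (u l).1)) +
        β * ∑ j ∈ T, ((u j).1 * (u b).2 - (u j).2 * (u b).1) *
        ((L.map fun c => c.1 * (u j).1 + c.2 * (u j).2).prod /
        ∏ l ∈ T.erase j, ((u j).1 * (u l).2 - (u j).2 * (u l).1)) := by
          rw [Finset.mul_sum, Finset.mul_sum, ← Finset.sum_add_distrib]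
          refine Finset.sum_congr rfl fun j _ => ?_
          rw [List.map_cons, List.prod_cons, hαβ]
          ring
      _ = 0 := by rw [key a ha, key b hb]; ring

/-- Summing over the edges at a vertex `i` is summing over the other vertices. -/
theorem sum_edge_incident {n : ℕ} (i : Fin n) (a : Fin n → ℝ) :
    ∑ e : Edge n, (if i = e.fst then a e.snd else if i = e.snd then a e.fst else 0) =
      ∑ j ∈ Finset.univ.erase i, a j := by
  classical
  rw [← Finset.sum_filter_add_sum_filter_not Finset.univ fun e : Edge n => i = e.fst ∨ i = e.snd]
  rw [Finset.sum_eq_zero (s := Finset.univ.filter fun e : Edge n => ¬ (i = e.fst ∨ i = e.snd)),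
    add_zero]
  · refine Finset.sum_bij' (fun e _ => if i = e.fst then e.snd else e.fst)
      (fun j hj => if h : i < j then ⟨(i, j), h⟩ else
        ⟨(j, i), lt_of_le_of_ne (not_lt.1 h) (Finset.ne_of_mem_erase hj)⟩) ?_ ?_ ?_ ?_ ?_
    · rintro ⟨⟨x, y⟩, hxy⟩ he
      simp only [Finset.mem_filter, Finset.mem_erase, Finset.mem_univ, true_and, and_true,
        Edge.fst, Edge.snd] at he ⊢
      split_ifs <;> grind
    · intro j hj
      split_ifs <;> simp [Edge.fst, Edge.snd]
    · rintro ⟨⟨x, y⟩, hxy⟩ he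
      simp only [Finset.mem_filter, Finset.mem_univ, true_and, Edge.fst, Edge.snd] at he
      dsimp only [Edge.fst, Edge.snd] at hxy ⊢
      rcases he with rfl | rfl
      · simp [hxy]
      · simp [hxy.ne', hxy.not_gt]
    · intro j hj
      have := Finset.ne_of_mem_erase hj
      by_cases h : i < j
      · simp [h, Edge.fst, Edge.snd]
      · simp [h, Edge.fst, this.symm]
    · rintro ⟨⟨x, y⟩, hxy⟩ he
      simp only [Finset.mem_filter, Finset.mem_univ, true_and, Edge.fst, Edge.snd] at he
      dsimp only [Edge.fst, Edge.snd] at hxy ⊢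
      rcases he with rfl | rfl
      · simp
      · simp [hxy.ne']
  · intro e he
    have := (Finset.mem_filter.1 he).2
    rw [not_or] at this
    simp [this.1, this.2]

/-! ### Crossings inside a set of `2 k + 3` vertices -/

/-- A `(k + 1)`-crossing whose endpoints lie in a set `S` of `2 k + 3` vertices misses a single
vertex of `S`, and contains every pair that halves the remaining vertices. -/
theorem exists_missing_vertex {n k : ℕ} {C : Finset (Edge n)} {S : Finset (Fin n)}
    (hcard : C.card = k + 1) (hcross : (C : Set (Edge n)).Pairwise Edge.Cross)
    (hS : S.card = 2 * k + 3) (hCS : ∀ e ∈ C, e.fst ∈ S ∧ e.snd ∈ S) :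
    ∃ v ∈ S, ∀ e : Edge n, e.fst ∈ S → e.snd ∈ S →
      ((S.filter fun l => e.fst < l ∧ l < e.snd).card = k ∧ (v < e.fst ∨ e.snd < v) ∨
        (S.filter fun l => e.fst < l ∧ l < e.snd).card = k + 1 ∧ e.fst < v ∧ v < e.snd) →
      e ∈ C := by
  classical
  have hX : ∀ e ∈ C, ∀ f ∈ C, e ≠ f → e.Cross f := fun e he f hf => hcross he hf
  have hlt : ∀ e ∈ C, ∀ f ∈ C, e.fst < f.snd := by
    intro e he f hf
    by_cases hef : e = f
    · exact hef ▸ e.2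
    · rcases hX e he f hf hef with h | h
      · exact h.1.trans (h.2.1.trans h.2.2)
      · exact h.2.1
  have hinj1 : Set.InjOn (Edge.fst (n := n)) C := by
    intro e he f hf h
    by_contra hef
    rcases hX e he f hf hef with h' | h'
    · exact h'.1.ne h
    · exact h'.1.ne h.symm
  have hinj2 : Set.InjOn (Edge.snd (n := n)) C := by
    intro e he f hf h
    by_contra hef
    rcases hX e he f hf hef with h' | h'
    · exact h'.2.2.ne h
    · exact h'.2.2.ne h.symm
  set V : Finset (Fin n) := C.image Edge.fst ∪ C.image Edge.snd with hV
  have hVS : V ⊆ S := by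
    intro x hx
    rcases Finset.mem_union.1 hx with h | h <;> obtain ⟨e, he, rfl⟩ := Finset.mem_image.1 h
    · exact (hCS e he).1
    · exact (hCS e he).2
  have hVcard : V.card = 2 * k + 2 := by
    rw [hV, Finset.card_union_of_disjoint, Finset.card_image_of_injOn hinj1,
      Finset.card_image_of_injOn hinj2, hcard]
    · ring
    · rw [Finset.disjoint_left]
      intro x h1 h2
      obtain ⟨e, he, rfl⟩ := Finset.mem_image.1 h1
      obtain ⟨f, hf, h⟩ := Finset.mem_image.1 h2
      exact (hlt e he f hf).ne' h
  -- Each of the other `k` edges of `C` has exactly one endpoint strictly between those of `e`.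
  have hin : ∀ e ∈ C, (V.filter fun l => e.fst < l ∧ l < e.snd).card = k := by
    intro e he
    have : (V.filter fun l => e.fst < l ∧ l < e.snd) =
        (C.erase e).image fun f => if e.fst < f.fst then f.fst else f.snd := by
      ext x
      simp only [Finset.mem_filter, Finset.mem_image, Finset.mem_erase, hV, Finset.mem_union]
      constructor
      · rintro ⟨⟨f, hf, rfl⟩ | ⟨f, hf, rfl⟩, h1, h2⟩
        · exact ⟨f, ⟨fun h => by rw [h] at h1; exact lt_irrefl _ h1, hf⟩, by simp [h1]⟩
        · have hne : f ≠ e := fun h => by rw [h] at h2; exact lt_irrefl _ h2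
          refine ⟨f, ⟨hne, hf⟩, ?_⟩
          rcases hX f hf e he hne with h | h
          · rw [if_neg h.1.not_gt]
          · exact absurd h2 h.2.2.not_gt
      · rintro ⟨f, ⟨hne, hf⟩, rfl⟩
        rcases hX f hf e he hne with h | h
        · rw [if_neg h.1.not_gt]
          exact ⟨Or.inr ⟨f, hf, rfl⟩, h.2.1, h.2.2⟩
        · rw [if_pos h.1]
          exact ⟨Or.inl ⟨f, hf, rfl⟩, h.1, h.2.1⟩
    rw [this, Finset.card_image_of_injOn, Finset.card_erase_of_mem he, hcard, Nat.add_sub_cancel]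
    intro f hf g hg hfg
    have hf' := Finset.mem_of_mem_erase hf
    have hg' := Finset.mem_of_mem_erase hg
    dsimp only at hfg
    split_ifs at hfg
    · exact hinj1 hf' hg' hfg
    · exact absurd hfg (hlt f hf' g hg').ne
    · exact absurd hfg (hlt g hg' f hf').ne'
    · exact hinj2 hf' hg' hfg
  have habove : ∀ e ∈ C, (V.filter fun l => e.snd < l).card ≤ k := by
    intro e he
    have : (V.filter fun l => e.snd < l) ⊆ (C.erase e).image Edge.snd := by
      intro x hx
      obtain ⟨hx1, hx2⟩ := Finset.mem_filter.1 hx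
      rcases Finset.mem_union.1 hx1 with h | h <;> obtain ⟨f, hf, rfl⟩ := Finset.mem_image.1 h
      · exact absurd hx2 (hlt f hf e he).not_gt
      · exact Finset.mem_image_of_mem _ (Finset.mem_erase.2
          ⟨fun h => by rw [h] at hx2; exact lt_irrefl _ hx2, hf⟩)
    refine (Finset.card_le_card this).trans (Finset.card_image_le.trans ?_)
    rw [Finset.card_erase_of_mem he, hcard, Nat.add_sub_cancel]
  -- If `e.fst` is the lower end of some `f ∈ C`, comparing counts of vertices in between forces `e
  -- = f`. It cannot be an upper end, since `k + 1` vertices of `V` lie above it.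
  have hmem : ∀ e : Edge n, e.fst ∈ V → e.snd ∈ V →
      (V.filter fun l => e.fst < l ∧ l < e.snd).card = k → e ∈ C := by
    intro e h1 h2 hk
    have hlt_card : ∀ A B : Finset (Fin n), ∀ y ∈ B, y ∉ A → A ⊆ B → A.card < B.card :=
      fun A B y hy hy' hAB => Finset.card_lt_card
        (Finset.ssubset_iff_of_subset hAB |>.2 ⟨y, hy, hy'⟩)
    rcases Finset.mem_union.1 h1 with h | h <;> obtain ⟨f, hf, hfe⟩ := Finset.mem_image.1 h
    · have hfk := hin f hf
      have hf2 : f.snd ∈ V := Finset.mem_union_right _ (Finset.mem_image_of_mem _ hf)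
      rcases lt_trichotomy f.snd e.snd with h' | h' | h'
      · have := hlt_card (V.filter fun l => f.fst < l ∧ l < f.snd)
          (V.filter fun l => e.fst < l ∧ l < e.snd) f.snd
          (Finset.mem_filter.2 ⟨hf2, hfe ▸ f.2, h'⟩) (by simp) (by
            intro l
            simp only [Finset.mem_filter, hfe]
            exact fun h => ⟨h.1, h.2.1, h.2.2.trans h'⟩)
        omega
      · have : f = e := Subtype.ext (Prod.ext hfe h')
        exact this ▸ hf
      · have := hlt_card (V.filter fun l => e.fst < l ∧ l < e.snd)
          (V.filter fun l => f.fst < l ∧ l < f.snd) e.snd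
          (Finset.mem_filter.2 ⟨h2, hfe.symm ▸ e.2, h'⟩) (by simp) (by
            intro l
            simp only [Finset.mem_filter, hfe]
            exact fun h => ⟨h.1, h.2.1, h.2.2.trans h'⟩)
        omega
    · have hfk := habove f hf
      have := hlt_card (V.filter fun l => e.fst < l ∧ l < e.snd)
          (V.filter fun l => f.snd < l) e.snd
          (Finset.mem_filter.2 ⟨h2, hfe.symm ▸ e.2⟩) (by simp) (by
            intro l
            simp only [Finset.mem_filter, hfe]
            exact fun h => ⟨h.1, h.2.1⟩)
      omega
  obtain ⟨v, hv⟩ := Finset.card_eq_one.1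
    (show (S \ V).card = 1 by rw [Finset.card_sdiff_of_subset hVS]; omega)
  have hvm : v ∈ S \ V := by simp [hv]
  have hVv : ∀ x, x ∈ V ↔ x ∈ S ∧ x ≠ v := by
    intro x
    constructor
    · intro hx
      exact ⟨hVS hx, fun h => (Finset.mem_sdiff.1 hvm).2 (h ▸ hx)⟩
    · rintro ⟨hx, hne⟩
      by_contra hxV
      have : x ∈ S \ V := Finset.mem_sdiff.2 ⟨hx, hxV⟩
      rw [hv] at this
      exact hne (Finset.mem_singleton.1 this)
  refine ⟨v, (Finset.mem_sdiff.1 hvm).1, fun e h1 h2 h => hmem e ?_ ?_ ?_⟩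
  · rw [hVv]
    refine ⟨h1, fun h' => ?_⟩
    have := e.2
    grind
  · rw [hVv]
    refine ⟨h2, fun h' => ?_⟩
    have := e.2
    grind
  · rcases h with ⟨h, hv'⟩ | ⟨h, hv'⟩
    · rw [← h]
      congr 1
      ext l
      simp only [Finset.mem_filter, hVv]
      grind
    · have : (V.filter fun l => e.fst < l ∧ l < e.snd) =
          (S.filter fun l => e.fst < l ∧ l < e.snd).erase v := by
        ext l
        simp only [Finset.mem_filter, Finset.mem_erase, hVv]
        tauto
      rw [this, Finset.card_erase_of_mem
        (Finset.mem_filter.2 ⟨(Finset.mem_sdiff.1 hvm).1, hv'⟩), h, Nat.add_sub_cancel]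

/-! ### The stress: symmetry, equilibrium and signs -/

theorem signedArea_swap_left (a b c : ℝ × ℝ) : signedArea b a c = -signedArea a b c := by
  simp only [signedArea]; ring

theorem signedArea_swap_right (a b c : ℝ × ℝ) : signedArea a c b = -signedArea a b c := by
  simp only [signedArea]; ring

/-- The coefficient of the pair `i, j` in the dependency of the cofactor matrix on the complete
graph with vertex set `S` that is associated with the point `r` of the plane. -/
noncomputable def edgeStress {n : ℕ} (q : Fin n → ℝ × ℝ) (S : Finset (Fin n)) (r : ℝ × ℝ)
    (i j : Fin n) : ℝ :=
  if i ∈ S ∧ j ∈ S then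
    signedArea (q i) (q j) r / ∏ l ∈ (S.erase i).erase j, signedArea (q i) (q j) (q l)
  else 0

/-- Exchanging `i` and `j` negates the numerator and each of the `2k + 1` factors of the
denominator, an even number of signs in all. -/
theorem edgeStress_symm {n k : ℕ} {q : Fin n → ℝ × ℝ} {S : Finset (Fin n)} (r : ℝ × ℝ)
    (hS : S.card = 2 * k + 3) {i j : Fin n} (hij : i ≠ j) :
    edgeStress q S r i j = edgeStress q S r j i := by
  unfold edgeStress
  by_cases h : i ∈ S ∧ j ∈ S
  · rw [if_pos h, if_pos h.symm, signedArea_swap_left (q j), Finset.erase_right_comm,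
      Finset.prod_congr rfl fun l _ => signedArea_swap_left (q j) (q i) (q l), Finset.prod_neg,
      Finset.card_erase_of_mem (Finset.mem_erase.2 ⟨hij, h.1⟩), Finset.card_erase_of_mem h.2, hS,
      Odd.neg_one_pow (by exact ⟨k, by omega⟩), neg_one_mul, neg_div_neg_eq]
  · rw [if_neg h, if_neg (by rwa [and_comm])]

theorem InConvexPosition.exists_sign {n : ℕ} {q : Fin n → ℝ × ℝ} (hq : InConvexPosition q) :
    ∃ ε : ℝ, ε * ε = 1 ∧ ∀ i j l : Fin n, i < j → j < l → 0 < ε * signedArea (q i) (q j) (q l) := by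
  rcases hq with h | h
  · exact ⟨1, by norm_num, fun i j l hij hjl => by simpa using h i j l hij hjl⟩
  · exact ⟨-1, by norm_num, fun i j l hij hjl => by simpa using h i j l hij hjl⟩

theorem InConvexPosition.signedArea_ne_zero {n : ℕ} {q : Fin n → ℝ × ℝ} (hq : InConvexPosition q)
    {i j l : Fin n} (hij : i ≠ j) (hil : i ≠ l) (hjl : j ≠ l) :
    signedArea (q i) (q j) (q l) ≠ 0 := by
  obtain ⟨ε, -, h⟩ := hq.exists_sign
  have h' : ∀ i j l : Fin n, i < j → j < l → signedArea (q i) (q j) (q l) ≠ 0 :=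
    fun i j l h1 h2 h0 => by simpa [h0] using h i j l h1 h2
  have hL := fun a b c => signedArea_swap_left (q a) (q b) (q c)
  have hR := fun a b c => signedArea_swap_right (q a) (q b) (q c)
  rcases lt_or_gt_of_ne hij with h1 | h1 <;> rcases lt_or_gt_of_ne hil with h2 | h2 <;>
    rcases lt_or_gt_of_ne hjl with h3 | h3
  · exact h' _ _ _ h1 h3
  · rw [hR i l j, neg_ne_zero]; exact h' _ _ _ h2 h3
  · exact absurd (h1.trans h3) h2.not_gt
  · rw [hR i l j, hL l i j, neg_neg]; exact h' _ _ _ h2 h1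
  · rw [hL j i l, neg_ne_zero]; exact h' _ _ _ h1 h2
  · exact absurd (h1.trans h2) h3.not_gt
  · rw [hL j i l, hR j l i, neg_neg]; exact h' _ _ _ h3 h2
  · rw [hL j i l, hR j l i, hL l j i, neg_neg, neg_ne_zero]; exact h' _ _ _ h3 h1

/-- The equilibrium of `edgeStress` at each vertex. -/
theorem sum_edgeStress_mul_prod_linear {n k : ℕ} (hk : 1 ≤ k) {q : Fin n → ℝ × ℝ}
    (hq : InConvexPosition q) {S : Finset (Fin n)} (hS : S.card = 2 * k + 3) (r : ℝ × ℝ)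
    (i : Fin n) (L : List (ℝ × ℝ)) (hL : L.length = 2 * k - 1) :
    ∑ j ∈ Finset.univ.erase i, edgeStress q S r i j *
      (L.map fun c => c.1 * (q i - q j).1 + c.2 * (q i - q j).2).prod = 0 := by
  by_cases hi : i ∈ S
  -- The form put in front of `L` takes the value `signedArea (q i) (q j) r` at `q i - q j`. With it
  -- there are `2k` forms against the `2k + 2` vertices of `S.erase i`.
  · have h := sum_prod_linear_div_prod_det_eq_zero (fun j => q i - q j)
      ((-(r.2 - (q i).2), r.1 - (q i).1) :: L) (S.erase i)
      (by rw [Finset.card_erase_of_mem hi, hS, List.length_cons, hL]; omega) (by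
        intro a ha b hb hab
        have := hq.signedArea_ne_zero (Finset.ne_of_mem_erase ha).symm
          (Finset.ne_of_mem_erase hb).symm hab
        convert this using 1
        simp only [signedArea, Prod.fst_sub, Prod.snd_sub]
        ring)
    rw [← h]
    symm
    refine (Finset.sum_congr rfl fun j hj => ?_).trans (Finset.sum_subset
      (Finset.erase_subset_erase _ (Finset.subset_univ _)) fun j hj hj' => ?_)
    · rw [edgeStress, if_pos ⟨hi, Finset.mem_of_mem_erase hj⟩, List.map_cons, List.prod_cons,
        div_mul_eq_mul_div]
      congr 1
      · congr 1
        simp only [signedArea, Prod.fst_sub, Prod.snd_sub]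
        ring
      · refine Finset.prod_congr rfl fun l _ => ?_
        simp only [signedArea, Prod.fst_sub, Prod.snd_sub]
        ring
    · rw [edgeStress, if_neg, zero_mul]
      rintro ⟨-, h⟩
      exact hj' (Finset.mem_erase.2 ⟨Finset.ne_of_mem_erase hj, h⟩)
  · refine Finset.sum_eq_zero fun j _ => ?_
    rw [edgeStress, if_neg (fun h => hi h.1), zero_mul]

/-- A factor `signedArea (q i) (q j) (q l)` has the sign of `ε`, reversed exactly when `l` lies
between `i` and `j`. The number `2k + 1` of factors is odd, so one `ε` survives. -/
theorem exists_edgeStress_eq {n k : ℕ} {q : Fin n → ℝ × ℝ} {ε : ℝ} (hε : ε * ε = 1)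
    (hq : ∀ i j l : Fin n, i < j → j < l → 0 < ε * signedArea (q i) (q j) (q l))
    {S : Finset (Fin n)} (hS : S.card = 2 * k + 3) (r : ℝ × ℝ) {i j : Fin n} (hi : i ∈ S)
    (hj : j ∈ S) (hij : i < j) :
    ∃ P : ℝ, 0 < P ∧ edgeStress q S r i j =
      (-1) ^ (S.filter fun l => i < l ∧ l < j).card * (ε * signedArea (q i) (q j) r) * P := by
  set T := (S.erase i).erase j with hT
  have hTcard : T.card = 2 * k + 1 := by
    rw [hT, Finset.card_erase_of_mem (Finset.mem_erase.2 ⟨hij.ne', hj⟩),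
      Finset.card_erase_of_mem hi, hS]
    omega
  set s : Fin n → ℝ := fun l => if i < l ∧ l < j then -1 else 1 with hs
  have hss : ∀ l, s l * s l = 1 := by
    intro l
    simp only [hs]
    split_ifs <;> norm_num
  have hpos : ∀ l ∈ T, 0 < ε * s l * signedArea (q i) (q j) (q l) := by
    intro l hl
    have hlj : l ≠ j := Finset.ne_of_mem_erase hl
    have hli : l ≠ i := Finset.ne_of_mem_erase (Finset.mem_of_mem_erase hl)
    simp only [hs]
    split_ifs with h
    · have := hq i l j h.1 h.2
      rw [signedArea_swap_right] at this
      linarith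
    · rcases lt_or_gt_of_ne hli with h1 | h1
      · have := hq l i j h1 hij
        rw [signedArea_swap_left, signedArea_swap_right] at this
        linarith
      · have := hq i j l hij (lt_of_le_of_ne (not_lt.1 fun h2 => h ⟨h1, h2⟩) hlj.symm)
        linarith
  have hprod : ∏ l ∈ T, signedArea (q i) (q j) (q l) =
      (-1) ^ (S.filter fun l => i < l ∧ l < j).card * ε *
        ∏ l ∈ T, (ε * s l * signedArea (q i) (q j) (q l)) := by
    have hfil : T.filter (fun l => i < l ∧ l < j) = S.filter fun l => i < l ∧ l < j := by
      ext l
      simp only [hT, Finset.mem_filter, Finset.mem_erase]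
      exact ⟨fun h => ⟨h.1.2.2, h.2⟩, fun h => ⟨⟨h.2.2.ne, h.2.1.ne', h.1⟩, h.2⟩⟩
    have hsprod : ∏ l ∈ T, s l = (-1) ^ (S.filter fun l => i < l ∧ l < j).card := by
      rw [hs, Finset.prod_ite, Finset.prod_const, Finset.prod_const_one, mul_one, hfil]
    have hεpow : ε ^ (2 * k + 1) = ε := by
      rw [pow_succ, pow_mul, pow_two, hε, one_pow, one_mul]
    rw [Finset.prod_mul_distrib, Finset.prod_mul_distrib, Finset.prod_const, hTcard, hεpow,
      hsprod]
    have h1 : ((-1 : ℝ) ^ (S.filter fun l => i < l ∧ l < j).card) *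
        (-1) ^ (S.filter fun l => i < l ∧ l < j).card = 1 := by
      rw [← mul_pow]; norm_num
    linear_combination (-∏ l ∈ T, signedArea (q i) (q j) (q l)) * hε * 1 -
      (ε * ε * ∏ l ∈ T, signedArea (q i) (q j) (q l)) * h1
  refine ⟨(∏ l ∈ T, (ε * s l * signedArea (q i) (q j) (q l)))⁻¹,
    inv_pos.2 (Finset.prod_pos hpos), ?_⟩
  have hP := (Finset.prod_pos hpos).ne'
  rw [edgeStress, if_pos ⟨hi, hj⟩, hprod]
  have hε0 : ε ≠ 0 := fun h => by simp [h] at hε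
  set Q := ∏ l ∈ T, (ε * s l * signedArea (q i) (q j) (q l))
  have h1 : ((-1 : ℝ) ^ (S.filter fun l => i < l ∧ l < j).card) *
      (-1) ^ (S.filter fun l => i < l ∧ l < j).card = 1 := by
    rw [← mul_pow]; norm_num
  set σ := ((-1 : ℝ) ^ (S.filter fun l => i < l ∧ l < j).card)
  have hσ : σ ≠ 0 := fun h => by simp [h] at h1
  rw [div_eq_iff (by positivity)]
  rw [show σ * (ε * signedArea (q i) (q j) r) * Q⁻¹ * (σ * ε * Q) =
    (σ * σ) * (ε * ε) * (Q⁻¹ * Q) * signedArea (q i) (q j) r by ring, h1, hε, inv_mul_cancel₀ hP]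
  ring

/-! ### The choice of `S` and `r` -/

theorem card_eq_of_forall_mem_iff_val {n : ℕ} (F : Finset (Fin n)) (T : Finset ℕ)
    (hT : ∀ x ∈ T, x < n) (h : ∀ l : Fin n, l ∈ F ↔ (l : ℕ) ∈ T) : F.card = T.card := by
  rw [← Finset.card_map Fin.valEmbedding]
  congr 1
  ext x
  simp only [Finset.mem_map, Fin.valEmbedding_apply]
  exact ⟨fun ⟨l, hl, hx⟩ => hx ▸ (h l).1 hl, fun hx => ⟨⟨x, hT x hx⟩, (h _).2 hx, rfl⟩⟩

/-- `e` halves the vertices of `S` other than `v`, of which there are `2 k + 2`. -/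
def Halves {n : ℕ} (k : ℕ) (S : Finset (Fin n)) (v : Fin n) (e : Edge n) : Prop :=
  e.fst ∈ S ∧ e.snd ∈ S ∧
    ((S.filter fun l => e.fst < l ∧ l < e.snd).card = k ∧ (v < e.fst ∨ e.snd < v) ∨
      (S.filter fun l => e.fst < l ∧ l < e.snd).card = k + 1 ∧ e.fst < v ∧ v < e.snd)

/-- Reduces a condition on all crossings to one halving edge per omitted vertex. A crossing that
leaves `S` has an edge where the stress vanishes, which `hp` covers. -/
theorem exists_mem_crossing_of_halves {n k : ℕ} {S : Finset (Fin n)} (hS : S.card = 2 * k + 3)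
    {p : Edge n → Prop} (hp : ∀ e : Edge n, ¬ (e.fst ∈ S ∧ e.snd ∈ S) → p e)
    (h : ∀ v, ∃ e, Halves k S v e ∧ p e) (C : Finset (Edge n)) (hcard : C.card = k + 1)
    (hcross : (C : Set (Edge n)).Pairwise Edge.Cross) : ∃ e ∈ C, p e := by
  by_cases hCS : ∀ e ∈ C, e.fst ∈ S ∧ e.snd ∈ S
  · obtain ⟨v, -, hv⟩ := exists_missing_vertex hcard hcross hS hCS
    obtain ⟨e, ⟨h1, h2, h3⟩, hpe⟩ := h v
    exact ⟨e, hv e h1 h2 h3, hpe⟩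
  · push Not at hCS
    obtain ⟨e, he, h'⟩ := hCS
    exact ⟨e, he, hp e fun h => h' h.1 h.2⟩

theorem signedArea_weighted {α β : ℝ} (h : α + β ≠ 0) (x y a c : ℝ × ℝ) :
    signedArea x y ((α * a.1 + β * c.1) / (α + β), (α * a.2 + β * c.2) / (α + β)) =
      (α * signedArea x y a + β * signedArea x y c) / (α + β) := by
  simp only [signedArea]
  field_simp
  ring

theorem card_filter_between {n : ℕ} (S : Finset (Fin n)) (i j : Fin n) (B : Finset ℕ)
    (hB : ∀ l : Fin n, i < l → l < j → (l ∈ S ↔ (l : ℕ) ∉ B)) (hBs : B ⊆ Finset.Ioo (i : ℕ) j) :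
    (S.filter fun l => i < l ∧ l < j).card = j - i - 1 - B.card := by
  rw [card_eq_of_forall_mem_iff_val _ (Finset.Ioo (i : ℕ) j \ B), Finset.card_sdiff_of_subset hBs,
    Nat.card_Ioo]
  · intro z hz
    exact (Finset.mem_Ioo.1 (Finset.mem_sdiff.1 hz).1).2.trans j.2
  · intro l
    rw [Finset.mem_filter, Finset.mem_sdiff, Finset.mem_Ioo, ← Fin.lt_def, ← Fin.lt_def]
    constructor
    · rintro ⟨h1, h2⟩
      exact ⟨h2, (hB l h2.1 h2.2).1 h1⟩
    · rintro ⟨h1, h2⟩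
      exact ⟨(hB l h1.1 h1.2).2 h2, h1⟩

theorem card_filter_ne_ne_ne {k n u v w : ℕ} (hn : 2 * k + 6 ≤ n) (huv : u < v) (hvw : v < w)
    (hw : w < 2 * k + 6) :
    (Finset.univ.filter fun l : Fin n => (l : ℕ) < 2 * k + 6 ∧ (l : ℕ) ≠ u ∧ (l : ℕ) ≠ v ∧
      (l : ℕ) ≠ w).card = 2 * k + 3 := by
  rw [card_eq_of_forall_mem_iff_val _ (((Finset.range (2 * k + 6)).erase w).erase v |>.erase u),
    Finset.card_erase_of_mem, Finset.card_erase_of_mem, Finset.card_erase_of_mem,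
    Finset.card_range]
  · omega
  all_goals simp only [Finset.mem_erase, Finset.mem_range, Finset.mem_filter, Finset.mem_univ,
    true_and]
  all_goals omega

set_option maxHeartbeats 400000 in
/-- For points in convex position some stress has neither a positive nor a negative
`(k + 1)`-crossing, yet involves a relevant edge. -/
theorem exists_edgeStress_crossing_free {k n : ℕ} (hk : 3 ≤ k) (hn : 2 * k + 6 ≤ n)
    {q : Fin n → ℝ × ℝ} (hq : InConvexPosition q) :
    ∃ (S : Finset (Fin n)) (r : ℝ × ℝ), S.card = 2 * k + 3 ∧
      (∀ C : Finset (Edge n), C.card = k + 1 → (C : Set (Edge n)).Pairwise Edge.Cross →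
        ∃ e ∈ C, (-1) ^ k * edgeStress q S r e.fst e.snd ≤ 0) ∧
      (∀ C : Finset (Edge n), C.card = k + 1 → (C : Set (Edge n)).Pairwise Edge.Cross →
        ∃ e ∈ C, 0 ≤ (-1) ^ k * edgeStress q S r e.fst e.snd) ∧
      ∃ e : Edge n, e.Relevant k ∧ (-1) ^ k * edgeStress q S r e.fst e.snd ≠ 0 := by
  obtain ⟨ε, hε, hpos⟩ := hq.exists_sign
  let N : (m : ℕ) → m < 2 * k + 6 → Fin n := fun m hm => ⟨m, hm.trans_le hn⟩
  set a := N 0 (by omega) with ha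
  set b := N (k + 1) (by omega) with hb
  set c := N (k + 3) (by omega) with hc
  set d := N (2 * k + 4) (by omega) with hd
  set x := N (k - 1) (by omega) with hx
  set y := N (2 * k + 2) (by omega) with hy
  have hva : (a : ℕ) = 0 := rfl
  have hvb : (b : ℕ) = k + 1 := rfl
  have hvc : (c : ℕ) = k + 3 := rfl
  have hvd : (d : ℕ) = 2 * k + 4 := rfl
  have hvx : (x : ℕ) = k - 1 := rfl
  have hvy : (y : ℕ) = 2 * k + 2 := rfl
  have hab : a < b := by rw [Fin.lt_def]; omega
  have hbc : b < c := by rw [Fin.lt_def]; omega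
  have hcd : c < d := by rw [Fin.lt_def]; omega
  have hac : a < c := hab.trans hbc
  have hbd : b < d := hbc.trans hcd
  have hxy : x < y := by rw [Fin.lt_def]; omega
  set α := ε * signedArea (q b) (q c) (q d) with hα
  set β := ε * signedArea (q a) (q b) (q d) with hβ
  have hα0 : 0 < α := hpos b c d hbc hcd
  have hβ0 : 0 < β := hpos a b d hab hbd
  -- The intersection of the diagonals `ac` and `bd`: these positive weights make the contributions
  -- of `a` and `c` to the signed area with `b`, `d` cancel.
  set r : ℝ × ℝ := ((α * (q a).1 + β * (q c).1) / (α + β), (α * (q a).2 + β * (q c).2) / (α + β))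
    with hr
  have hrac : signedArea (q a) (q c) r = 0 := by
    rw [hr, signedArea_weighted (add_pos hα0 hβ0).ne']
    simp only [signedArea]
    ring
  have hrbd : signedArea (q b) (q d) r = 0 := by
    rw [hr, signedArea_weighted (add_pos hα0 hβ0).ne', hα, hβ]
    simp only [signedArea]
    ring
  have hsq : ((-1 : ℝ) ^ k) * (-1) ^ k = 1 := by rw [← mul_pow]; norm_num
  have hzero : ∀ (S : Finset (Fin n)) (i j : Fin n), signedArea (q i) (q j) r = 0 →
      (-1) ^ k * edgeStress q S r i j = 0 := by
    intro S i j h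
    simp [edgeStress, h]
  have hout : ∀ (S : Finset (Fin n)) (e : Edge n), ¬ (e.fst ∈ S ∧ e.snd ∈ S) →
      (-1) ^ k * edgeStress q S r e.fst e.snd = 0 := by
    intro S e h
    rw [edgeStress, if_neg h, mul_zero]
  have hodd : ∀ (S : Finset (Fin n)) (i j : Fin n), S.card = 2 * k + 3 → i ∈ S → j ∈ S → i < j →
      (S.filter fun l => i < l ∧ l < j).card = k + 1 →
      ∃ P : ℝ, 0 < P ∧ (-1) ^ k * edgeStress q S r i j =
        -(ε * signedArea (q i) (q j) r) * P := by
    intro S i j hS hi hj hij h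
    obtain ⟨P, hP, h'⟩ := exists_edgeStress_eq hε hpos hS r hi hj hij
    refine ⟨P, hP, ?_⟩
    rw [h', h, pow_succ]
    linear_combination (-(ε * signedArea (q i) (q j) r) * P) * hsq
  have heven : ∀ (S : Finset (Fin n)) (i j : Fin n), S.card = 2 * k + 3 → i ∈ S → j ∈ S → i < j →
      (S.filter fun l => i < l ∧ l < j).card = k →
      ∃ P : ℝ, 0 < P ∧ (-1) ^ k * edgeStress q S r i j =
        (ε * signedArea (q i) (q j) r) * P := by
    intro S i j hS hi hj hij h
    obtain ⟨P, hP, h'⟩ := exists_edgeStress_eq hε hpos hS r hi hj hij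
    refine ⟨P, hP, ?_⟩
    rw [h', h]
    linear_combination ((ε * signedArea (q i) (q j) r) * P) * hsq
  -- The two cases give `xy` respectively `k + 1` and `k` vertices of `S` in between, so that its
  -- coefficient, normalised by `(-1) ^ k`, is `≤ 0` in both.
  rcases le_total 0 (ε * signedArea (q x) (q y) r) with hsign | hsign
  · set z := N (k + 4) (by omega) with hz
    have hvz : (z : ℕ) = k + 4 := rfl
    have haz : a < z := by rw [Fin.lt_def]; omega
    have hcz : c < z := by rw [Fin.lt_def]; omega
    -- Omitting `1`, `k + 2`, `2k + 3` leaves `k` vertices inside each of `ac` and `bd`, so only `b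
    -- ≤ v ≤ c` remains for `xy` and `az`. Here `3 ≤ k` keeps `x = k - 1` different from the omitted
    -- `1`.
    set S := Finset.univ.filter fun l : Fin n => (l : ℕ) < 2 * k + 6 ∧ (l : ℕ) ≠ 1 ∧
      (l : ℕ) ≠ k + 2 ∧ (l : ℕ) ≠ 2 * k + 3 with hSdef
    have hS : S.card = 2 * k + 3 := card_filter_ne_ne_ne hn (by omega) (by omega) (by omega)
    have hmS : ∀ l : Fin n, l ∈ S ↔ (l : ℕ) < 2 * k + 6 ∧ (l : ℕ) ≠ 1 ∧
      (l : ℕ) ≠ k + 2 ∧ (l : ℕ) ≠ 2 * k + 3 := fun l => by simp [hSdef]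
    have c1 : (S.filter fun l => a < l ∧ l < c).card = k := by
      rw [card_filter_between S a c {1, k + 2}, Finset.card_pair (by omega)]
      · omega
      · intro l
        simp only [hmS, Fin.lt_def, Finset.mem_insert, Finset.mem_singleton]
        omega
      · intro l
        simp only [Finset.mem_Ioo, Finset.mem_insert, Finset.mem_singleton]
        omega
    have c2 : (S.filter fun l => b < l ∧ l < d).card = k := by
      rw [card_filter_between S b d {k + 2, 2 * k + 3}, Finset.card_pair (by omega)]
      · omega
      · intro l
        simp only [hmS, Fin.lt_def, Finset.mem_insert, Finset.mem_singleton]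
        omega
      · intro l
        simp only [Finset.mem_Ioo, Finset.mem_insert, Finset.mem_singleton]
        omega
    have c3 : (S.filter fun l => x < l ∧ l < y).card = k + 1 := by
      rw [card_filter_between S x y {k + 2}, Finset.card_singleton]
      · omega
      · intro l
        simp only [hmS, Fin.lt_def, Finset.mem_singleton]
        omega
      · intro l
        simp only [Finset.mem_Ioo, Finset.mem_singleton]
        omega
    have c4 : (S.filter fun l => a < l ∧ l < z).card = k + 1 := by
      rw [card_filter_between S a z {1, k + 2}, Finset.card_pair (by omega)]
      · omega
      · intro l
        simp only [hmS, Fin.lt_def, Finset.mem_insert, Finset.mem_singleton]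
        omega
      · intro l
        simp only [Finset.mem_Ioo, Finset.mem_insert, Finset.mem_singleton]
        omega
    have maS : a ∈ S := (hmS a).2 (by omega)
    have mbS : b ∈ S := (hmS b).2 (by omega)
    have mcS : c ∈ S := (hmS c).2 (by omega)
    have mdS : d ∈ S := (hmS d).2 (by omega)
    have mxS : x ∈ S := (hmS x).2 (by omega)
    have myS : y ∈ S := (hmS y).2 (by omega)
    have mzS : z ∈ S := (hmS z).2 (by omega)
    have s3 : (-1) ^ k * edgeStress q S r x y ≤ 0 := by
      obtain ⟨P, hP, h⟩ := hodd S x y hS mxS myS hxy c3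
      rw [h]
      exact mul_nonpos_of_nonpos_of_nonneg (neg_nonpos.2 hsign) hP.le
    have s4 : 0 < (-1) ^ k * edgeStress q S r a z := by
      obtain ⟨P, hP, h⟩ := hodd S a z hS maS mzS haz c4
      -- Only the `c`-component of `r` contributes, since `a` lies on the line `az`.
      rw [h, hr, signedArea_weighted (add_pos hα0 hβ0).ne', signedArea_swap_right (q a) (q c) (q z)]
      refine mul_pos ?_ hP
      have : signedArea (q a) (q z) (q a) = 0 := by simp [signedArea]
      rw [this, mul_zero, zero_add, mul_neg, neg_div, mul_neg, neg_neg, mul_div_assoc',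
        mul_left_comm]
      exact div_pos (mul_pos hβ0 (hpos a c z hac hcz)) (add_pos hα0 hβ0)
    refine ⟨S, r, hS, exists_mem_crossing_of_halves hS (fun e he => (hout S e he).le) fun v => ?_,
      exists_mem_crossing_of_halves hS (fun e he => (hout S e he).ge) fun v => ?_,
      ⟨(a, z), haz⟩, ?_, s4.ne'⟩
    · by_cases h1 : v < a ∨ c < v
      · exact ⟨⟨(a, c), hac⟩, ⟨maS, mcS, Or.inl ⟨c1, h1⟩⟩, (hzero _ _ _ hrac).le⟩
      by_cases h2 : v < b ∨ d < v
      · exact ⟨⟨(b, d), hbd⟩, ⟨mbS, mdS, Or.inl ⟨c2, h2⟩⟩, (hzero _ _ _ hrbd).le⟩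
      refine ⟨⟨(x, y), hxy⟩, ⟨mxS, myS, Or.inr ⟨c3, ?_⟩⟩, s3⟩
      simp only [Fin.lt_def, Edge.fst, Edge.snd] at h1 h2 ⊢
      omega
    · by_cases h1 : v < a ∨ c < v
      · exact ⟨⟨(a, c), hac⟩, ⟨maS, mcS, Or.inl ⟨c1, h1⟩⟩, (hzero _ _ _ hrac).ge⟩
      by_cases h2 : v < b ∨ d < v
      · exact ⟨⟨(b, d), hbd⟩, ⟨mbS, mdS, Or.inl ⟨c2, h2⟩⟩, (hzero _ _ _ hrbd).ge⟩
      refine ⟨⟨(a, z), haz⟩, ⟨maS, mzS, Or.inr ⟨c4, ?_⟩⟩, s4.le⟩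
      simp only [Fin.lt_def, Edge.fst, Edge.snd] at h1 h2 ⊢
      omega
    · simp only [Edge.Relevant, Edge.length, Edge.fst, Edge.snd, hva, hvz]
      omega
  · set z := N 1 (by omega) with hz
    have hvz : (z : ℕ) = 1 := rfl
    have hzc : z < c := by rw [Fin.lt_def]; omega
    have haz : a < z := by rw [Fin.lt_def]; omega
    -- Omitting `k`, `k + 4`, `2k + 5` leaves `k + 1` vertices inside each of `ac` and `bd`, so only
    -- `v ≤ a` or `d ≤ v` remains for `xy` and `zc`. Here `3 ≤ k` places `k + 4` below `y = 2k + 2`.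
    set S := Finset.univ.filter fun l : Fin n => (l : ℕ) < 2 * k + 6 ∧ (l : ℕ) ≠ k ∧
      (l : ℕ) ≠ k + 4 ∧ (l : ℕ) ≠ 2 * k + 5 with hSdef
    have hS : S.card = 2 * k + 3 := card_filter_ne_ne_ne hn (by omega) (by omega) (by omega)
    have hmS : ∀ l : Fin n, l ∈ S ↔ (l : ℕ) < 2 * k + 6 ∧ (l : ℕ) ≠ k ∧
      (l : ℕ) ≠ k + 4 ∧ (l : ℕ) ≠ 2 * k + 5 := fun l => by simp [hSdef]
    have c1 : (S.filter fun l => a < l ∧ l < c).card = k + 1 := by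
      rw [card_filter_between S a c {k}, Finset.card_singleton]
      · omega
      · intro l
        simp only [hmS, Fin.lt_def, Finset.mem_singleton]
        omega
      · intro l
        simp only [Finset.mem_Ioo, Finset.mem_singleton]
        omega
    have c2 : (S.filter fun l => b < l ∧ l < d).card = k + 1 := by
      rw [card_filter_between S b d {k + 4}, Finset.card_singleton]
      · omega
      · intro l
        simp only [hmS, Fin.lt_def, Finset.mem_singleton]
        omega
      · intro l
        simp only [Finset.mem_Ioo, Finset.mem_singleton]
        omega
    have c3 : (S.filter fun l => x < l ∧ l < y).card = k := by
      rw [card_filter_between S x y {k, k + 4}, Finset.card_pair (by omega)]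
      · omega
      · intro l
        simp only [hmS, Fin.lt_def, Finset.mem_insert, Finset.mem_singleton]
        omega
      · intro l
        simp only [Finset.mem_Ioo, Finset.mem_insert, Finset.mem_singleton]
        omega
    have c4 : (S.filter fun l => z < l ∧ l < c).card = k := by
      rw [card_filter_between S z c {k}, Finset.card_singleton]
      · omega
      · intro l
        simp only [hmS, Fin.lt_def, Finset.mem_singleton]
        omega
      · intro l
        simp only [Finset.mem_Ioo, Finset.mem_singleton]
        omega
    have maS : a ∈ S := (hmS a).2 (by omega)
    have mbS : b ∈ S := (hmS b).2 (by omega)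
    have mcS : c ∈ S := (hmS c).2 (by omega)
    have mdS : d ∈ S := (hmS d).2 (by omega)
    have mxS : x ∈ S := (hmS x).2 (by omega)
    have myS : y ∈ S := (hmS y).2 (by omega)
    have mzS : z ∈ S := (hmS z).2 (by omega)
    have s3 : (-1) ^ k * edgeStress q S r x y ≤ 0 := by
      obtain ⟨P, hP, h⟩ := heven S x y hS mxS myS hxy c3
      rw [h]
      exact mul_nonpos_of_nonpos_of_nonneg hsign hP.le
    have s4 : 0 < (-1) ^ k * edgeStress q S r z c := by
      obtain ⟨P, hP, h⟩ := heven S z c hS mzS mcS hzc c4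
      rw [h, hr, signedArea_weighted (add_pos hα0 hβ0).ne', signedArea_swap_right (q z) (q a) (q c),
        signedArea_swap_left (q a) (q z) (q c), neg_neg]
      refine mul_pos ?_ hP
      have : signedArea (q z) (q c) (q c) = 0 := by simp only [signedArea]; ring
      rw [this, mul_zero, add_zero, mul_div_assoc', mul_left_comm]
      exact div_pos (mul_pos hα0 (hpos a z c haz hzc)) (add_pos hα0 hβ0)
    refine ⟨S, r, hS, exists_mem_crossing_of_halves hS (fun e he => (hout S e he).le) fun v => ?_,
      exists_mem_crossing_of_halves hS (fun e he => (hout S e he).ge) fun v => ?_,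
      ⟨(z, c), hzc⟩, ?_, s4.ne'⟩
    · by_cases h1 : a < v ∧ v < c
      · exact ⟨⟨(a, c), hac⟩, ⟨maS, mcS, Or.inr ⟨c1, h1⟩⟩, (hzero _ _ _ hrac).le⟩
      by_cases h2 : b < v ∧ v < d
      · exact ⟨⟨(b, d), hbd⟩, ⟨mbS, mdS, Or.inr ⟨c2, h2⟩⟩, (hzero _ _ _ hrbd).le⟩
      refine ⟨⟨(x, y), hxy⟩, ⟨mxS, myS, Or.inl ⟨c3, ?_⟩⟩, s3⟩
      simp only [Fin.lt_def, Edge.fst, Edge.snd] at h1 h2 ⊢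
      omega
    · by_cases h1 : a < v ∧ v < c
      · exact ⟨⟨(a, c), hac⟩, ⟨maS, mcS, Or.inr ⟨c1, h1⟩⟩, (hzero _ _ _ hrac).ge⟩
      by_cases h2 : b < v ∧ v < d
      · exact ⟨⟨(b, d), hbd⟩, ⟨mbS, mdS, Or.inr ⟨c2, h2⟩⟩, (hzero _ _ _ hrbd).ge⟩
      refine ⟨⟨(z, c), hzc⟩, ⟨mzS, mcS, Or.inl ⟨c4, ?_⟩⟩, s4.le⟩
      simp only [Fin.lt_def, Edge.fst, Edge.snd] at h1 h2 ⊢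
      omega
    · simp only [Edge.Relevant, Edge.length, Edge.fst, Edge.snd, hvc, hvz]
      omega

/-! ### Transfer to the three matrices -/

/-- Positive weights `w` leave all signs unchanged, so one crossing argument serves every matrix
whose rows, rescaled by `w`, satisfy the stress. -/
theorem not_realizesMultiassociahedron_of_stress {k n : ℕ} {κ : Type*} (hk : 3 ≤ k)
    (hn : 2 * k + 6 ≤ n) {q : Fin n → ℝ × ℝ} (hq : InConvexPosition q) {M : Matrix (Edge n) κ ℝ}
    (w : Edge n → ℝ) (hw : ∀ e, 0 < w e)
    (h : ∀ (S : Finset (Fin n)) (r : ℝ × ℝ), S.card = 2 * k + 3 →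
      ∑ e : Edge n, (edgeStress q S r e.fst e.snd * w e) • M.row e = 0) :
    ¬ RealizesMultiassociahedron k M := by
  obtain ⟨S, r, hS, h1, h2, e, he, hne⟩ := exists_edgeStress_crossing_free hk hn hq
  refine not_realizesMultiassociahedron_of_dependency
    (fun e => (-1) ^ k * edgeStress q S r e.fst e.snd * w e) ?_ ?_ ?_
    ⟨e, he, mul_ne_zero hne (hw e).ne'⟩
  · simp only [mul_assoc, mul_smul _ (_ * _), ← Finset.smul_sum, h S r hS, smul_zero]
  · intro C hC hX
    obtain ⟨e, he, hle⟩ := h1 C hC hX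
    exact ⟨e, he, mul_nonpos_of_nonpos_of_nonneg hle (hw e).le⟩
  · intro C hC hX
    obtain ⟨e, he, hle⟩ := h2 C hC hX
    exact ⟨e, he, mul_nonneg hle (hw e).le⟩

/-- A dependency among rows supported on the blocks of their endpoints can be checked block by
block. -/
theorem sum_smul_row_eq_zero {n : ℕ} {κ : Type*} {M : Matrix (Edge n) (Fin n × κ) ℝ}
    {Ω : Edge n → ℝ} (a : Fin n → κ → Fin n → ℝ)
    (hfst : ∀ e m, Ω e * M e (e.fst, m) = a e.fst m e.snd)
    (hsnd : ∀ e m, Ω e * M e (e.snd, m) = a e.snd m e.fst)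
    (hzero : ∀ e i m, i ≠ e.fst → i ≠ e.snd → M e (i, m) = 0)
    (ha : ∀ i m, ∑ j ∈ Finset.univ.erase i, a i m j = 0) :
    ∑ e, Ω e • M.row e = 0 := by
  ext ⟨i, m⟩
  rw [Finset.sum_apply, Pi.zero_apply, ← ha i m, ← sum_edge_incident]
  refine Finset.sum_congr rfl fun e _ => ?_
  rw [Pi.smul_apply, smul_eq_mul, Matrix.row_apply]
  split_ifs with h1 h2
  · subst h1; exact hfst e m
  · subst h2; exact hsnd e m
  · rw [hzero e i m h1 h2, mul_zero]

theorem cofactorVec_swap {k : ℕ} (hk : 1 ≤ k) (a b : ℝ × ℝ) (m : Fin (2 * k)) :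
    cofactorVec (2 * k) b a m = -cofactorVec (2 * k) a b m := by
  have hm := m.2
  have hodd : Odd ((m : ℕ) + (2 * k - 1 - m)) := ⟨k - 1, by omega⟩
  simp only [cofactorVec]
  rw [← neg_sub a.2, ← neg_sub a.1, neg_pow (a.2 - b.2), neg_pow (a.1 - b.1)]
  have : (-1 : ℝ) ^ ((m : ℕ) + (2 * k - 1 - m)) = -1 := hodd.neg_one_pow
  rw [pow_add] at this
  linear_combination ((a.2 - b.2) ^ (m : ℕ) * (a.1 - b.1) ^ (2 * k - 1 - (m : ℕ))) * this

theorem inConvexPosition_parabola {n : ℕ} {t : Fin n → ℝ} (ht : StrictMono t) :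
    InConvexPosition fun i => (t i, t i ^ 2) := by
  refine Or.inl fun i j l hij hjl => ?_
  have h1 := sub_pos.2 (ht hij)
  have h2 := sub_pos.2 (ht hjl)
  have h3 := sub_pos.2 (ht (hij.trans hjl))
  have : signedArea (t i, t i ^ 2) (t j, t j ^ 2) (t l, t l ^ 2) =
      (t j - t i) * (t l - t j) * (t l - t i) := by
    simp only [signedArea]; ring
  rw [this]
  positivity

/-- On the parabola the forms `-t i * x + y` and `x` take the values `(t i - t j) * t j` and `t i -
t j` at `q i - q j`. Taking `m` copies of the first and `2k - 1 - m` of the second gives the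
monomial `t j ^ m`. -/
theorem sum_edgeStress_parabola {n k : ℕ} (hk : 1 ≤ k) {t : Fin n → ℝ} (ht : StrictMono t)
    {S : Finset (Fin n)} (hS : S.card = 2 * k + 3) (r : ℝ × ℝ) (i : Fin n) {m : ℕ}
    (hm : m < 2 * k) :
    ∑ j ∈ Finset.univ.erase i, edgeStress (fun i => (t i, t i ^ 2)) S r i j *
      (t j - t i) ^ (2 * k - 1) * t j ^ m = 0 := by
  have h := sum_edgeStress_mul_prod_linear hk (inConvexPosition_parabola ht) hS r i
    (List.replicate m (-t i, 1) ++ List.replicate (2 * k - 1 - m) (1, 0))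
    (by simp only [List.length_append, List.length_replicate]; omega)
  rw [← neg_eq_zero, ← Finset.sum_neg_distrib, ← h]
  refine Finset.sum_congr rfl fun j _ => ?_
  have hodd : Odd (2 * k - 1) := ⟨k - 1, by omega⟩
  simp only [List.map_append, List.map_replicate, List.prod_append, List.prod_replicate,
    Prod.fst_sub, Prod.snd_sub, one_mul, zero_mul, add_zero]
  rw [show -t i * (t i - t j) + (t i ^ 2 - t j ^ 2) = (t i - t j) * t j by ring, mul_pow,
    ← neg_sub (t i), hodd.neg_pow, show 2 * k - 1 = m + (2 * k - 1 - m) by omega, pow_add,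
    Nat.add_sub_cancel_left]
  ring

theorem theorem1p6 (k n : ℕ) (hk : 3 ≤ k) (hn : 2 * k + 6 ≤ n) :
    (∀ q : Fin n → ℝ × ℝ, InConvexPosition q →
      ¬ RealizesMultiassociahedron k (cofactorMatrix (2 * k) q)) ∧
    (∀ t : Fin n → ℝ, StrictMono t →
      ¬ RealizesMultiassociahedron k (barJointMatrix fun i => momentPoint (2 * k) (t i))) ∧
    (∀ t : Fin n → ℝ, StrictMono t →
      ¬ RealizesMultiassociahedron k
        (hyperconnectivityMatrix fun i => linearMomentPoint (2 * k) (t i))) := by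
  have hk1 : 1 ≤ k := by omega
  refine ⟨fun q hq => ?_, fun t ht => ?_, fun t ht => ?_⟩
  · refine not_realizesMultiassociahedron_of_stress hk hn hq 1 (fun _ => one_pos) fun S r hS => ?_
    refine sum_smul_row_eq_zero
      (fun i m j => edgeStress q S r i j * cofactorVec (2 * k) (q i) (q j) m) ?_ ?_ ?_ ?_
    · intro e m
      simp [cofactorMatrix]
    · intro e m
      have : e.snd ≠ e.fst := e.2.ne'
      simp only [cofactorMatrix, Matrix.of_apply, if_neg this, if_true, Pi.one_apply, mul_one]
      rw [edgeStress_symm r hS this, cofactorVec_swap hk1, neg_neg]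
    · intro e i m h1 h2
      simp only [cofactorMatrix, Matrix.of_apply, if_neg h1, if_neg h2]
    · intro i m
      have hm := m.2
      have h := sum_edgeStress_mul_prod_linear hk1 hq hS r i
        (List.replicate m (0, 1) ++ List.replicate (2 * k - 1 - m) (1, 0))
        (by simp only [List.length_append, List.length_replicate]; omega)
      simpa [cofactorVec] using h
  · refine not_realizesMultiassociahedron_of_stress hk hn (inConvexPosition_parabola ht)
      (fun e => (t e.snd - t e.fst) ^ (2 * k - 2)) (fun e => pow_pos (sub_pos.2 (ht e.2)) _)
      fun S r hS => ?_
    refine sum_smul_row_eq_zero (fun i m j => edgeStress (fun i => (t i, t i ^ 2)) S r i j *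
      (t j - t i) ^ (2 * k - 2) * (t i ^ ((m : ℕ) + 1) - t j ^ ((m : ℕ) + 1))) ?_ ?_ ?_ ?_
    · intro e m
      simp [barJointMatrix, momentPoint]
    · intro e m
      have : e.snd ≠ e.fst := e.2.ne'
      have heven : Even (2 * k - 2) := ⟨k - 1, by omega⟩
      simp only [barJointMatrix, momentPoint, Matrix.of_apply, if_neg this, if_true]
      rw [edgeStress_symm r hS this, ← neg_sub (t e.fst), heven.neg_pow]
    · intro e i m h1 h2
      simp only [barJointMatrix, Matrix.of_apply, if_neg h1, if_neg h2]
    · intro i m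
      -- Factoring `t j - t i` out of the difference of powers raises the exponent `2k - 2` to `2k -
      -- 1` and leaves monomials `t j ^ s` with `s ≤ m < 2k`, each covered by
      -- `sum_edgeStress_parabola`.
      have h : ∀ j, edgeStress (fun i => (t i, t i ^ 2)) S r i j * (t j - t i) ^ (2 * k - 2) *
          (t i ^ ((m : ℕ) + 1) - t j ^ ((m : ℕ) + 1)) =
          -∑ s ∈ Finset.range (m + 1), t i ^ (m - s : ℕ) *
            (edgeStress (fun i => (t i, t i ^ 2)) S r i j * (t j - t i) ^ (2 * k - 1) *
              t j ^ s) := by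
        intro j
        rw [← neg_sub (t j ^ ((m : ℕ) + 1)), ← geom_sum₂_mul, mul_neg, neg_inj, Finset.sum_mul,
          Finset.mul_sum]
        refine Finset.sum_congr rfl fun s _ => ?_
        rw [show 2 * k - 1 = (2 * k - 2) + 1 by omega, pow_succ (t j - t i),
          Nat.add_sub_cancel]
        ring
      rw [Finset.sum_congr rfl fun j _ => h j, Finset.sum_neg_distrib, Finset.sum_comm,
        Finset.sum_eq_zero, neg_zero]
      intro s hs
      rw [← Finset.mul_sum, sum_edgeStress_parabola hk1 ht hS r i, mul_zero]
      have := m.2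
      have := Finset.mem_range.1 hs
      omega
  · refine not_realizesMultiassociahedron_of_stress hk hn (inConvexPosition_parabola ht)
      (fun e => (t e.snd - t e.fst) ^ (2 * k - 1)) (fun e => pow_pos (sub_pos.2 (ht e.2)) _)
      fun S r hS => ?_
    refine sum_smul_row_eq_zero (fun i m j => edgeStress (fun i => (t i, t i ^ 2)) S r i j *
      (t j - t i) ^ (2 * k - 1) * t j ^ (m : ℕ)) ?_ ?_ ?_
      fun i m => sum_edgeStress_parabola hk1 ht hS r i m.2
    · intro e m
      simp [hyperconnectivityMatrix, linearMomentPoint]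
    · intro e m
      have : e.snd ≠ e.fst := e.2.ne'
      -- The odd power of `t j - t i` absorbs the minus sign in the second block of the row.
      have hodd : Odd (2 * k - 1) := ⟨k - 1, by omega⟩
      simp only [hyperconnectivityMatrix, linearMomentPoint, Matrix.of_apply, if_neg this, if_true]
      rw [edgeStress_symm r hS this, ← neg_sub (t e.snd) (t e.fst), hodd.neg_pow]
      ring
    · intro e i m h1 h2
      simp only [hyperconnectivityMatrix, Matrix.of_apply, if_neg h1, if_neg h2]
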